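/- Let $V,\lambda,T>0$, let $\mathbb T=\mathbb R/\mathbb Z$ be the one-dimensional torus and $\Omega_V=\mathbb T\times\{-V,V\}$, with velocity reversal $\iota(x,v)=(x,-v)$. For $X=\mathbb T$ or $X=\Omega_V$ let $\mathcal M(X)$ be the space of finite signed Borel measures and $\mathcal P(X)\subset\mathcal M(X)$ the set of probability measures, both with the narrow topology. Define $\Pi_V:\mathcal M(\Omega_V)\to\mathcal M(\mathbb T)\times\mathcal M(\mathbb T)$ by $$(\Pi_V\sigma)(dx)=\Bigl(\sum_{v=\pm V}\sigma(dx,v),\ \sum_{v=\pm V}v\,\sigma(dx,v)\Bigr),\qquad \bigl(\Pi_V^{-1}(\rho,\omega)\bigr)(dx,v)=\tfrac12\Bigl(\rho(dx)+\tfrac1v\,\omega(dx)\Bigr).$$ A curve $\sigma\in C([0,T];\mathcal P(\Omega_V))$ is a weak solution of the Kac equation $\partial_t\sigma+v\,\partial_x\sigma=\lambda(\iota_\sharp\sigma-\sigma)$ with initial datum $\sigma_0$ if $\sigma|_{t=0}=\sigma_0$ and, for all $\varphi:\Omega_V\to\mathbb R$ of class $C^1$ in $x$ and all $0\le s\le t\le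 T$, $$\int\varphi\,d\sigma_t-\int\varphi\,d\sigma_s=\int_s^t\int_{\Omega_V}\bigl(v\,\partial_x\varphi+\lambda(\varphi\circ\iota-\varphi)\bigr)\,d\sigma_r\,dr .$$ A pair $(\rho,\omega)$ of curves on $[0,T]$, with $\rho\in C([0,T];\mathcal P(\mathbb T))$, with $\omega_t\in\mathcal M(\mathbb T)$ for $t\in[0,T]$ and $\omega\in C((0,T);\mathcal M(\mathbb T))$, is a weak solution of the FC system $\partial_t\rho=-\partial_x\omega$, $\partial_t\omega=-V^2\partial_x\rho-2\lambda\omega$ with initial datum $(\rho_0,\omega_0)$ if $(\rho,\omega)|_{t=0}=(\rho_0,\omega_0)$, $\int_0^T\|\lambda\,\omega_t\|_{TV}\,dt<\infty$ and, for all $\varphi,\psi\in C^1(\mathbb T)$ and all $0\le s\le t\le T$, $$\int\varphi\,d\rho_t-\int\varphi\,d\rho_s=\int_s^t\int_{\mathbb T}\partial_x\varphi\,d\omega_r\,dr,\qquad \int\psi\,d\omega_t-\int\psi\,d\omega_s=V^2\int_s^t\int_{\mathbb T}\partial_x\psi\,d\rho_r\,dr-2\lambda\int_s^t\int_{\mathbb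 T}\psi\,d\omega_r\,dr .$$ For either equation, "the weak solution" with a given initial datum means a weak solution that coincides on $[0,T]$ with every weak solution with the same initial datum. **Theorem.** (i) If $\sigma$ is a weak solution of the Kac equation with initial datum $\sigma_0\in\mathcal P(\Omega_V)$, then $(\rho,\omega):=\Pi_V\sigma$ is the weak solution of the FC system with initial datum $(\rho_0,\omega_0)=\Pi_V\sigma_0$. (ii) Conversely, if $(\rho,\omega)$ is a weak solution of the FC system with initial datum $(\rho_0,\omega_0)\in\mathcal P(\mathbb T)\times\mathcal M(\mathbb T)$ such that $-V\rho_0\le\omega_0\le V\rho_0$, then $\sigma:=\Pi_V^{-1}(\rho,\omega)$ is the weak solution of the Kac equation with initial datum $\sigma_0=\Pi_V^{-1}(\rho_0,\omega_0)$. -/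

import Mathlib

open MeasureTheory Set

noncomputable section

namespace KacFC

/-- The one-dimensional torus `𝕋 = ℝ / ℤ`. -/
abbrev Torus : Type := UnitAddCircle

/-- The set of velocities `{-V, V}`. -/
abbrev Velocity (V : ℝ) : Type := ({-V, V} : Set ℝ)

instance (V : ℝ) : Fintype (Velocity V) := Fintype.ofFinite _

/-- The state space `Ω_V = 𝕋 × {-V, V}`. -/
abbrev Omega (V : ℝ) : Type := Torus × Velocity V

/-- The velocity reversal `v ↦ -v` on `{-V, V}`. -/
def velNeg {V : ℝ} (v : Velocity V) : Velocity V :=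
  ⟨-(v : ℝ), by rcases v.2 with h | h <;> simp_all⟩

/-- The velocity-reversal map `ι (x, v) = (x, -v)` on `Ω_V`. -/
def iota {V : ℝ} (p : Omega V) : Omega V := (p.1, velNeg p.2)

/-! ### Signed measures, probability measures, narrow topology -/

/-- A signed measure is a probability measure if it is nonnegative with total mass one.  In this way
`𝒫(X)` is a subset of `ℳ(X)`, the space of finite signed measures. -/
def IsProb {X : Type*} [MeasurableSpace X] (μ : SignedMeasure X) : Prop :=
  0 ≤ μ ∧ μ univ = 1

/-- Continuity on `I ⊆ ℝ` of a curve of signed measures, with respect to the narrow topology, that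
is, the initial topology for the functionals `μ ↦ ∫ f dμ` with `f` continuous and bounded. -/
def NarrowContinuousOn {X : Type*} [MeasurableSpace X] [TopologicalSpace X]
    (μ : ℝ → SignedMeasure X) (I : Set ℝ) : Prop :=
  ∀ f : BoundedContinuousFunction X ℝ, ContinuousOn (fun t => ∫ᵛ x, f x ∂<•(μ t)) I

/-- The total variation norm of a signed measure. -/
def tvNorm {X : Type*} [MeasurableSpace X] (μ : SignedMeasure X) : ENNReal :=
  μ.variation univ

/-- `(K t)` with `0 < t < T` is a measurable family of signed measures: all the functions
`t ↦ K t B`, with `B` a measurable set, are measurable on `(0, T)`. -/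
def MeasurableFamily {X : Type*} [MeasurableSpace X] (T : ℝ) (K : ℝ → SignedMeasure X) : Prop :=
  ∀ B : Set X, MeasurableSet B → Measurable (fun t : Ioo (0 : ℝ) T => K t B)

/-! ### Test functions -/

/-- `φ ∈ C¹(𝕋)`: the 1-periodic lift of `φ` to `ℝ` is continuously differentiable. -/
def IsC1 (φ : Torus → ℝ) : Prop := ContDiff ℝ 1 (fun y : ℝ => φ (y : Torus))

/-- The derivative `∂ₓφ` of a function on the torus. -/
def torusDeriv (φ : Torus → ℝ) (x : Torus) : ℝ := deriv (fun h : ℝ => φ (x + (h : Torus))) 0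

/-- `φ ∈ C^{1,0}(Ω_V)`: continuously differentiable in `x` for each of the two velocities
(continuity in the discrete variable `v` is automatic). -/
def IsC10 {V : ℝ} (φ : Omega V → ℝ) : Prop := ∀ v : Velocity V, IsC1 (fun x => φ (x, v))

/-! ### The Kac equation -/

/-- The generator `(Qφ)(x, v) = v ∂ₓφ(x, v) + λ ((φ ∘ ι)(x, v) - φ(x, v))`. -/
def kacGen {V : ℝ} (lam : ℝ) (φ : Omega V → ℝ) (p : Omega V) : ℝ :=
  (p.2 : ℝ) * torusDeriv (fun x => φ (x, p.2)) p.1 + lam * (φ (iota p) - φ p)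

/-- The curve `σ` (restricted to `[0, T]`) is a weak solution, with initial datum `σ₀`, of the Kac
equation `∂ₜσ + v ∂ₓσ = λ (ι_# σ - σ)`. -/
structure IsKacWeakSol (V lam T : ℝ) (σ₀ : SignedMeasure (Omega V))
    (σ : ℝ → SignedMeasure (Omega V)) : Prop where
  prob : ∀ t ∈ Icc 0 T, IsProb (σ t)
  cont : NarrowContinuousOn σ (Icc 0 T)
  init : σ 0 = σ₀
  weak : ∀ φ : Omega V → ℝ, IsC10 φ → ∀ s t : ℝ, 0 ≤ s → s ≤ t → t ≤ T →
    ∫ᵛ p, φ p ∂<•(σ t) - ∫ᵛ p, φ p ∂<•(σ s) = ∫ r in s..t, ∫ᵛ p, kacGen lam φ p ∂<•(σ r)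

/-- `σ` is *the* weak solution of the Kac equation with initial datum `σ₀`: it is a weak solution,
and it coincides on `[0, T]` with any weak solution with the same initial datum. -/
def IsTheKacWeakSol (V lam T : ℝ) (σ₀ : SignedMeasure (Omega V))
    (σ : ℝ → SignedMeasure (Omega V)) : Prop :=
  IsKacWeakSol V lam T σ₀ σ ∧ ∀ σ', IsKacWeakSol V lam T σ₀ σ' → EqOn σ' σ (Icc 0 T)

/-! ### The FC system -/

/-- The triple `(ρ, ω, K)` solves the momentum equation
`∂ₜρ + ∂ₓω = 0`, `∂ₜω + V² ∂ₓρ = -2 K` on `(0, T) × 𝕋`. The curve `ω` is continuous on `(0, T)`,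
and it has values at `0` and `T`, which enter the weak equation. The field `intble` says
that the time integral of `ω` in the weak equations makes sense. -/
structure IsMomentumSol (V T : ℝ) (ρ ω K : ℝ → SignedMeasure Torus) : Prop where
  prob : ∀ t ∈ Icc 0 T, IsProb (ρ t)
  cont_density : NarrowContinuousOn ρ (Icc 0 T)
  cont_flux : NarrowContinuousOn ω (Ioo 0 T)
  meas : MeasurableFamily T K
  tv : ∫⁻ t in Ioo 0 T, tvNorm (K t) < ⊤
  intble : ∀ φ : Torus → ℝ, IsC1 φ →
    IntervalIntegrable (fun r => ∫ᵛ x, torusDeriv φ x ∂<•(ω r)) volume 0 T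
  weak_density : ∀ φ : Torus → ℝ, IsC1 φ → ∀ s t : ℝ, 0 ≤ s → s ≤ t → t ≤ T →
    ∫ᵛ x, φ x ∂<•(ρ t) - ∫ᵛ x, φ x ∂<•(ρ s) = ∫ r in s..t, ∫ᵛ x, torusDeriv φ x ∂<•(ω r)
  weak_flux : ∀ ψ : Torus → ℝ, IsC1 ψ → ∀ s t : ℝ, 0 ≤ s → s ≤ t → t ≤ T →
    ∫ᵛ x, ψ x ∂<•(ω t) - ∫ᵛ x, ψ x ∂<•(ω s)
      = V ^ 2 * (∫ r in s..t, ∫ᵛ x, torusDeriv ψ x ∂<•(ρ r))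
        - 2 * (∫ r in s..t, ∫ᵛ x, ψ x ∂<•(K r))

/-- `(ρ, ω)` is a weak solution, with initial datum `(ρ₀, ω₀)`, of the FC system
`∂ₜρ = -∂ₓω`, `∂ₜω = -V² ∂ₓρ - 2 λ ω`. -/
structure IsFCWeakSol (V lam T : ℝ) (ρ₀ ω₀ : SignedMeasure Torus)
    (ρ ω : ℝ → SignedMeasure Torus) : Prop where
  momentum : IsMomentumSol V T ρ ω (fun t => lam • ω t)
  init_density : ρ 0 = ρ₀
  init_flux : ω 0 = ω₀

/-- `(ρ, ω)` is *the* weak solution of the FC system with initial datum `(ρ₀, ω₀)`: it is a weak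
solution, and it coincides on `[0, T]` with any weak solution with the same initial datum. -/
def IsTheFCWeakSol (V lam T : ℝ) (ρ₀ ω₀ : SignedMeasure Torus)
    (ρ ω : ℝ → SignedMeasure Torus) : Prop :=
  IsFCWeakSol V lam T ρ₀ ω₀ ρ ω ∧
    ∀ ρ' ω', IsFCWeakSol V lam T ρ₀ ω₀ ρ' ω' → EqOn ρ' ρ (Icc 0 T) ∧ EqOn ω' ω (Icc 0 T)

/-! ### The change of variables -/

/-- The signed measure `j(dx, v)` on `𝕋`, that is, `B ↦ j (B × {v})`. -/
def slice {V : ℝ} (j : SignedMeasure (Omega V)) (v : Velocity V) : SignedMeasure Torus :=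
  (j.restrict (univ ×ˢ {v})).map Prod.fst

/-- `Π_V j = (∑_v j(dx, v), ∑_v v j(dx, v))`. -/
def proj {V : ℝ} (j : SignedMeasure (Omega V)) : SignedMeasure Torus × SignedMeasure Torus :=
  (∑ v : Velocity V, slice j v, ∑ v : Velocity V, (v : ℝ) • slice j v)

/-- `(Π_V⁻¹ J)(dx, v) = (J₁(dx) + J₂(dx) / v) / 2`. -/
def projInv (V : ℝ) (J : SignedMeasure Torus × SignedMeasure Torus) : SignedMeasure (Omega V) :=
  ∑ v : Velocity V, ((1 / 2 : ℝ) • (J.1 + (1 / (v : ℝ)) • J.2)).map (fun x => (x, v))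

end KacFC

end

/-! The change of variables is a linear bijection between measures on the phase space and pairs
(density, flux). Testing Kac with `φ(x)` and `v ψ(x)` gives the two FC equations. Conversely, the
density equation plus `1/v` times the flux equation, tested with each `φ(·, v)` and halved, sums to
the Kac equation (`integral_kacGen_projInv`). What FC does not carry over by algebra is positivity,
and neither problem hands over uniqueness.

Both come from a minimum principle for signed solutions of Kac (`IsSignedKacSol.nonneg`):
nonnegative initial data stay nonnegative. Uniqueness follows by applying it to a difference and to
its negative (`IsSignedKacSol.eqOn`); positivity follows because `-V ρ₀ ≤ ω₀ ≤ V ρ₀` says exactly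
that the Kac initial datum is nonnegative.

The minimum principle is proved on `f(t, x, v) = ∫ η(y + x) σ_t(dy, v)`, which solves the
backward-looking equation `∂ₜf = v ∂ₓf + λ (f(-v) - f(v))` in integrated form. If `η` is a
trigonometric polynomial, `f` is a finite sum of smooth functions of `x` times continuous moments of
`σ_t`, so it is regular enough for a pointwise argument although no bound on the total variation of
`σ_t` uniform in time is assumed. Stone–Weierstrass then passes to all nonnegative continuous test
functions. -/

noncomputable section

namespace KacFC

open Filter Topology
open scoped NNReal ENNReal

/-! ### Signed measures: integral bounds, positivity and measurability -/

section SignedMeasureFacts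

variable {X : Type*} [MeasurableSpace X]

instance isFiniteMeasure_variation (μ : SignedMeasure X) : IsFiniteMeasure μ.variation := by
  rw [← SignedMeasure.totalVariation_eq_variation]; infer_instance

lemma exists_measure_of_nonneg {μ : SignedMeasure X} (h : 0 ≤ μ) :
    ∃ m : Measure X, ∃ _ : IsFiniteMeasure m, μ = m.toSignedMeasure := by
  have h' := (VectorMeasure.le_restrict_univ_iff_le 0 μ).2 h
  exact ⟨μ.toMeasureOfZeroLE univ MeasurableSet.univ h', inferInstance,
    (SignedMeasure.toMeasureOfZeroLE_toSignedMeasure μ h').symm⟩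

lemma integral_nonneg_of_nonneg {μ : SignedMeasure X} (h : 0 ≤ μ) {f : X → ℝ}
    (hf : ∀ x, 0 ≤ f x) : 0 ≤ ∫ᵛ x, f x ∂<•μ := by
  obtain ⟨m, _, rfl⟩ := exists_measure_of_nonneg h
  rw [VectorMeasure.integral_toSignedMeasure]
  exact integral_nonneg hf

lemma variation_univ_of_nonneg {μ : SignedMeasure X} (h : 0 ≤ μ) :
    μ.variation univ = ENNReal.ofReal (μ univ) := by
  obtain ⟨m, _, rfl⟩ := exists_measure_of_nonneg h
  simp

lemma abs_integral_le {μ : SignedMeasure X} {f : X → ℝ} {C : ℝ} (hC : 0 ≤ C)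
    (h : ∀ x, |f x| ≤ C) :
    |∫ᵛ x, f x ∂<•μ| ≤ C * μ.variation.real univ := by
  refine (VectorMeasure.norm_integral_le_of_norm_le_const (μ := μ) (f := f)
    (B := (ContinuousLinearMap.lsmul ℝ ℝ).flip) (C := C) (ae_of_all _ fun x => h x)).trans ?_
  have hB : ‖(ContinuousLinearMap.lsmul ℝ ℝ (E := ℝ)).flip‖ ≤ 1 := by
    rw [ContinuousLinearMap.opNorm_flip]
    exact ContinuousLinearMap.opNorm_lsmul_le
  gcongr
  nlinarith

lemma integral_one (μ : SignedMeasure X) : ∫ᵛ _, (1 : ℝ) ∂<•μ = μ univ := by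
  simp [VectorMeasure.integral_const]

lemma integral_const_mul_signed (μ : SignedMeasure X) (c : ℝ) (f : X → ℝ) :
    ∫ᵛ x, c * f x ∂<•μ = c * ∫ᵛ x, f x ∂<•μ :=
  VectorMeasure.integral_fun_smul _ _ c f

variable [TopologicalSpace X] [BorelSpace X]

lemma integrable_of_continuous [CompactSpace X] (μ : SignedMeasure X) {f : X → ℝ}
    (hf : Continuous f) : μ.Integrable f := by
  obtain ⟨C, hC⟩ := isCompact_univ.exists_bound_of_continuousOn hf.continuousOn
  exact Integrable.of_bound hf.aestronglyMeasurable C (ae_of_all _ fun x => hC x trivial)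

/-- Outer approximation of the indicator of `F` and dominated convergence. The sequence is chosen
before the measure, so that one sequence serves a whole curve of measures. -/
lemma exists_seq_tendsto_integral [HasOuterApproxClosed X] {F : Set X} (hF : IsClosed F) :
    ∃ f : ℕ → BoundedContinuousFunction X ℝ, (∀ n x, 0 ≤ f n x) ∧
      ∀ μ : SignedMeasure X, Tendsto (fun n => ∫ᵛ x, f n x ∂<•μ) atTop (𝓝 (μ F)) := by
  refine ⟨fun n => BoundedContinuousFunction.mkOfBound
    ⟨fun x => (hF.apprSeq n x : ℝ), by fun_prop⟩ 1 fun x y => ?_, fun n x => ?_, fun μ => ?_⟩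
  · rw [Real.dist_eq, abs_le]
    have h1 := HasOuterApproxClosed.apprSeq_apply_le_one hF n x
    have h2 := HasOuterApproxClosed.apprSeq_apply_le_one hF n y
    have h1' : (hF.apprSeq n x : ℝ) ≤ 1 := by exact_mod_cast h1
    have h2' : (hF.apprSeq n y : ℝ) ≤ 1 := by exact_mod_cast h2
    have h3 : 0 ≤ (hF.apprSeq n x : ℝ) := NNReal.coe_nonneg _
    have h4 : 0 ≤ (hF.apprSeq n y : ℝ) := NNReal.coe_nonneg _
    constructor <;> simp <;> linarith
  · exact NNReal.coe_nonneg _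
  · have key : μ F = ∫ᵛ x, F.indicator (fun _ => (1 : ℝ)) x ∂<•μ := by
      rw [VectorMeasure.integral_indicator hF.measurableSet, integral_one]
      simp
    rw [key]
    refine VectorMeasure.tendsto_integral_filter_of_norm_le_const
      (Eventually.of_forall fun n => ?_) ⟨1, Eventually.of_forall fun n => ae_of_all _ fun x => ?_⟩
      (ae_of_all _ fun x => ?_)
    · exact (BoundedContinuousFunction.continuous _).aestronglyMeasurable
    · have h1' : (hF.apprSeq n x : ℝ) ≤ 1 := by exact_mod_cast HasOuterApproxClosed.apprSeq_apply_le_one hF n x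
      simpa using h1'
    · have h := tendsto_pi_nhds.1 (HasOuterApproxClosed.tendsto_apprSeq hF) x
      have h2 := (NNReal.continuous_coe.tendsto _).comp h
      refine h2.congr' ?_ |>.trans_eq ?_
      · exact Eventually.of_forall fun n => rfl
      · congr 1
        by_cases hx : x ∈ F <;> simp [hx]

end SignedMeasureFacts

lemma nonneg_of_forall_integral_nonneg {X : Type*} [MeasurableSpace X] [PseudoMetricSpace X]
    [BorelSpace X] {μ : SignedMeasure X}
    (h : ∀ f : X → ℝ, Continuous f → (∀ x, 0 ≤ f x) → 0 ≤ ∫ᵛ x, f x ∂<•μ) : 0 ≤ μ := by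
  have hcl : ∀ F : Set X, IsClosed F → 0 ≤ μ F := fun F hF => by
    obtain ⟨f, hf0, hf⟩ := exists_seq_tendsto_integral hF
    exact ge_of_tendsto' (hf μ) fun n => h _ (f n).continuous (hf0 n)
  -- Positivity on closed sets compares the two Jordan parts there; inner regularity of the negative
  -- part by closed sets extends the comparison to all measurable sets.
  have hle : μ.toJordanDecomposition.negPart ≤ μ.toJordanDecomposition.posPart := by
    refine Measure.le_iff.2 fun B hB => ?_
    rw [hB.measure_eq_iSup_isClosed_of_ne_top (measure_ne_top _ _)]
    refine iSup_le fun F => iSup_le fun hFB => iSup_le fun hF => ?_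
    refine le_trans ?_ (measure_mono hFB)
    have h1 := hcl F hF
    rw [μ.apply_eq_posPart_real_sub_negPart_real hF.measurableSet, sub_nonneg] at h1
    exact (ENNReal.toReal_le_toReal (measure_ne_top _ _) (measure_ne_top _ _)).1 h1
  intro B hB
  have := (ENNReal.toReal_le_toReal (measure_ne_top _ _) (measure_ne_top _ _)).2
    (Measure.le_iff.1 hle B hB)
  rw [μ.apply_eq_posPart_real_sub_negPart_real hB]
  simpa [Measure.real] using this

/-- On a closed set the mass is a pointwise limit of functions continuous in time; closed sets form
a π-system generating the Borel sets, and a Dynkin argument does the rest. -/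
lemma measurableFamily_of_narrowContinuousOn {X : Type*} [MeasurableSpace X] [PseudoMetricSpace X]
    [BorelSpace X] {T : ℝ} {μ : ℝ → SignedMeasure X} (h : NarrowContinuousOn μ (Ioo 0 T)) :
    MeasurableFamily T μ := by
  have hcl : ∀ F : Set X, IsClosed F → Measurable fun t : Ioo (0 : ℝ) T => μ t F := by
    intro F hF
    obtain ⟨f, -, hf⟩ := exists_seq_tendsto_integral hF
    refine measurable_of_tendsto_metrizable
      (f := fun n (t : Ioo (0 : ℝ) T) => ∫ᵛ x, f n x ∂<•(μ t)) (fun n => ?_)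
      (tendsto_pi_nhds.2 fun t => hf (μ t))
    exact (continuousOn_iff_continuous_domRestrict.1 (h (f n))).measurable
  intro B hB
  have hgen := (BorelSpace.measurable_eq (α := X)).trans borel_eq_generateFrom_isClosed
  induction B, hB using MeasurableSpace.induction_on_inter hgen isPiSystem_isClosed with
  | empty => simp
  | basic F hF => exact hcl F hF
  | compl B hB ih =>
    simp_rw [VectorMeasure.of_compl hB]
    exact (hcl univ isClosed_univ).sub ih
  | iUnion f hd hm ih =>
    have : ∀ t : Ioo (0 : ℝ) T, Tendsto (fun n => ∑ i ∈ Finset.range n, μ t (f i)) atTop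
        (𝓝 (μ t (⋃ i, f i))) := fun t =>
      (VectorMeasure.hasSum_of_disjoint_iUnion hm hd).tendsto_sum_nat
    refine measurable_of_tendsto_metrizable
      (f := fun n (t : Ioo (0 : ℝ) T) => ∑ i ∈ Finset.range n, μ t (f i)) (fun n => ?_)
      (tendsto_pi_nhds.2 this)
    exact Finset.measurable_fun_sum _ fun i _ => ih i

/-! ### Slicing by velocity and the change of variables -/

section Slices

variable {V : ℝ}

lemma continuous_omega_iff {φ : Omega V → ℝ} :
    Continuous φ ↔ ∀ v : Velocity V, Continuous fun x => φ (x, v) :=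
  continuous_prod_of_discrete_right

lemma measurableEmbedding_slice (v : Velocity V) :
    MeasurableEmbedding (fun x : Torus => ((x, v) : Omega V)) :=
  MeasurableEmbedding.prodMk_right MeasurableEmbedding.id v

lemma sum_velocity (hV : 0 < V) {M : Type*} [AddCommMonoid M] (f : Velocity V → M) :
    ∑ v, f v = f ⟨V, by simp⟩ + f ⟨-V, by simp⟩ := by
  classical
  have hne : (⟨V, by simp⟩ : Velocity V) ≠ ⟨-V, by simp⟩ := by
    intro h
    have : V = -V := congrArg Subtype.val h
    linarith
  rw [← Finset.sum_pair hne]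
  congr 1
  ext ⟨v, hv⟩
  rcases hv with rfl | rfl <;> simp

lemma velocity_sq (v : Velocity V) : (v : ℝ) * v = V ^ 2 := by
  rcases v.2 with h | h <;> rw [h] <;> ring

@[simp] lemma velNeg_velNeg (v : Velocity V) : velNeg (velNeg v) = v :=
  Subtype.ext (neg_neg _)

@[simp] lemma coe_velNeg (v : Velocity V) : ((velNeg v : Velocity V) : ℝ) = -v := rfl

lemma slice_apply (j : SignedMeasure (Omega V)) (v : Velocity V) {B : Set Torus}
    (hB : MeasurableSet B) : slice j v B = j (B ×ˢ {v}) := by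
  rw [slice, VectorMeasure.map_apply _ measurable_fst hB,
    VectorMeasure.restrict_apply _ (MeasurableSet.univ.prod (measurableSet_singleton v))
      (measurable_fst hB)]
  congr 1
  ext ⟨x, w⟩
  simp

lemma slice_nonneg {j : SignedMeasure (Omega V)} (h : 0 ≤ j) (v : Velocity V) :
    0 ≤ slice j v := by
  intro B hB
  rw [slice_apply _ _ hB]
  exact h _ (hB.prod (measurableSet_singleton v))

/-- The sets `B ∩ (𝕋 × {v})` partition `B`. With `slice_sum_map` this makes a measure equivalent to
its family of slices, so the change of variables reduces to inverting a 2 × 2 system. -/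
lemma sum_slice_map (j : SignedMeasure (Omega V)) :
    ∑ v, (slice j v).map (fun x => ((x, v) : Omega V)) = j := by
  ext B hB
  have hm : ∀ v : Velocity V, MeasurableSet ((fun x => ((x, v) : Omega V)) ⁻¹' B) := fun v =>
    (measurableEmbedding_slice v).measurable hB
  have h1 : (∑ v, (slice j v).map (fun x => ((x, v) : Omega V))) B
      = ∑ v, j (((fun x => ((x, v) : Omega V)) ⁻¹' B) ×ˢ {v}) := by
    simp only [FunLike.coe_sum, Finset.sum_apply]
    refine Finset.sum_congr rfl fun v _ => ?_
    rw [VectorMeasure.map_apply _ (measurableEmbedding_slice v).measurable hB,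
      slice_apply _ _ (hm v)]
  rw [h1, ← VectorMeasure.of_biUnion_finset]
  · congr 1
    ext ⟨x, w⟩
    simp only [Finset.mem_univ, iUnion_true, mem_iUnion, mem_prod, mem_preimage,
      mem_singleton_iff]
    exact ⟨fun ⟨v, h1, h2⟩ => h2 ▸ h1, fun h => ⟨w, h, rfl⟩⟩
  · intro v _ w _ hvw
    refine Set.disjoint_left.2 fun p hp hp' => hvw ?_
    exact hp.2.symm.trans hp'.2
  · exact fun v _ => (hm v).prod (measurableSet_singleton v)

lemma slice_sum_map (μ : Velocity V → SignedMeasure Torus) (v : Velocity V) :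
    slice (∑ w, (μ w).map (fun x => ((x, w) : Omega V))) v = μ v := by
  classical
  ext B hB
  rw [slice_apply _ _ hB]
  simp only [FunLike.coe_sum, Finset.sum_apply]
  rw [Finset.sum_eq_single v]
  · rw [VectorMeasure.map_apply _ (measurableEmbedding_slice v).measurable
      (hB.prod (measurableSet_singleton v))]
    congr 1
    ext x
    simp
  · intro w _ hw
    rw [VectorMeasure.map_apply _ (measurableEmbedding_slice w).measurable
      (hB.prod (measurableSet_singleton v))]
    have : (fun x => ((x, w) : Omega V)) ⁻¹' B ×ˢ {v} = ∅ := by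
      ext x
      simp [hw]
    rw [this, VectorMeasure.empty]
  · simp

lemma integral_eq_sum_slice (j : SignedMeasure (Omega V)) {φ : Omega V → ℝ}
    (hφ : Continuous φ) : ∫ᵛ p, φ p ∂<•j = ∑ v, ∫ᵛ x, φ (x, v) ∂<•(slice j v) := by
  conv_lhs => rw [← sum_slice_map j]
  rw [VectorMeasure.integral_finsetSum_vectorMeasure fun v _ => integrable_of_continuous _ hφ]
  exact Finset.sum_congr rfl fun v _ => (measurableEmbedding_slice v).integral_map_vectorMeasure

lemma slice_projInv (J : SignedMeasure Torus × SignedMeasure Torus) (v : Velocity V) :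
    slice (projInv V J) v = (1 / 2 : ℝ) • (J.1 + (1 / (v : ℝ)) • J.2) :=
  slice_sum_map _ v

lemma projInv_proj (hV : 0 < V) (j : SignedMeasure (Omega V)) : projInv V (proj j) = j := by
  conv_rhs => rw [← sum_slice_map j]
  refine Finset.sum_congr rfl fun v _ => ?_
  congr 1
  simp only [proj, sum_velocity hV]
  ext B -
  rcases v with ⟨v, hv⟩
  rcases hv with rfl | rfl <;>
  · simp
    field_simp
    ring

lemma proj_projInv (hV : 0 < V) (J : SignedMeasure Torus × SignedMeasure Torus) :
    proj (projInv V J) = J := by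
  refine Prod.ext ?_ ?_
  all_goals
    simp only [proj, slice_projInv, sum_velocity hV]
    ext B -
    simp
    field_simp
    ring

lemma integral_proj_fst (j : SignedMeasure (Omega V)) {f : Torus → ℝ} (hf : Continuous f) :
    ∫ᵛ x, f x ∂<•(proj j).1 = ∫ᵛ p, f p.1 ∂<•j := by
  rw [integral_eq_sum_slice j (by fun_prop), proj]
  exact VectorMeasure.integral_finsetSum_vectorMeasure fun v _ => integrable_of_continuous _ hf

lemma integral_proj_snd (j : SignedMeasure (Omega V)) {f : Torus → ℝ} (hf : Continuous f) :
    ∫ᵛ x, f x ∂<•(proj j).2 = ∫ᵛ p, (p.2 : ℝ) * f p.1 ∂<•j := by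
  rw [integral_eq_sum_slice j (by fun_prop), proj]
  refine (VectorMeasure.integral_finsetSum_vectorMeasure
    fun v _ => integrable_of_continuous _ hf).trans (Finset.sum_congr rfl fun v _ => ?_)
  rw [VectorMeasure.integral_smul_vectorMeasure]
  exact (integral_const_mul_signed _ (v : ℝ) f).symm

lemma integral_projInv (J : SignedMeasure Torus × SignedMeasure Torus) {φ : Omega V → ℝ}
    (hφ : Continuous φ) :
    ∫ᵛ p, φ p ∂<•(projInv V J) = ∑ v : Velocity V,
      (1 / 2 : ℝ) * (∫ᵛ x, φ (x, v) ∂<•J.1 + 1 / (v : ℝ) * ∫ᵛ x, φ (x, v) ∂<•J.2) := by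
  rw [integral_eq_sum_slice _ hφ]
  refine Finset.sum_congr rfl fun v _ => ?_
  have hv := continuous_omega_iff.1 hφ v
  rw [slice_projInv, VectorMeasure.integral_smul_vectorMeasure,
    VectorMeasure.integral_add_vectorMeasure (integrable_of_continuous _ hv)
      (integrable_of_continuous _ hv), VectorMeasure.integral_smul_vectorMeasure]
  simp only [smul_eq_mul]

end Slices

/-! ### Differential calculus on the torus -/

section TorusCalculus

lemma continuous_torus_iff {f : Torus → ℝ} : Continuous f ↔ Continuous fun y : ℝ => f y :=
  QuotientAddGroup.isOpenQuotientMap_mk.isQuotientMap.continuous_iff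

lemma IsC1.continuous {φ : Torus → ℝ} (h : IsC1 φ) : Continuous φ :=
  continuous_torus_iff.2 (ContDiff.continuous h)

lemma torusDeriv_coe (φ : Torus → ℝ) (y : ℝ) :
    torusDeriv φ y = deriv (fun z : ℝ => φ z) y := by
  have : (fun h : ℝ => φ ((y : Torus) + (h : Torus))) = fun h : ℝ => (fun z : ℝ => φ z) (y + h) := by
    ext h
    simp only [AddCircle.coe_add]
  rw [torusDeriv, this, deriv_comp_const_add (fun z : ℝ => φ z), add_zero]

lemma IsC1.continuous_torusDeriv {φ : Torus → ℝ} (h : IsC1 φ) : Continuous (torusDeriv φ) := by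
  rw [continuous_torus_iff]
  simp_rw [torusDeriv_coe]
  exact ContDiff.continuous_deriv_one h

lemma IsC1.hasDerivAt {φ : Torus → ℝ} (h : IsC1 φ) (x : Torus) :
    HasDerivAt (fun s : ℝ => φ (x + (s : Torus))) (torusDeriv φ x) 0 := by
  obtain ⟨y, rfl⟩ := QuotientAddGroup.mk_surjective x
  refine DifferentiableAt.hasDerivAt ?_
  have : (fun s : ℝ => φ ((y : Torus) + (s : Torus))) = fun s : ℝ => (fun z : ℝ => φ z) (y + s) := by
    ext h
    simp only [AddCircle.coe_add]
  exact this ▸ ((ContDiff.differentiable h one_ne_zero).comp (by fun_prop)) 0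

lemma torusDeriv_eq {φ : Torus → ℝ} {x : Torus} {d : ℝ}
    (h : HasDerivAt (fun s : ℝ => φ (x + (s : Torus))) d 0) : torusDeriv φ x = d :=
  h.deriv

lemma isC1_const (c : ℝ) : IsC1 fun _ => c := contDiff_const

lemma IsC1.mul {φ ψ : Torus → ℝ} (hφ : IsC1 φ) (hψ : IsC1 ψ) : IsC1 fun x => φ x * ψ x :=
  ContDiff.mul hφ hψ

lemma IsC1.sum {ι : Type*} {s : Finset ι} {φ : ι → Torus → ℝ} (h : ∀ i ∈ s, IsC1 (φ i)) :
    IsC1 fun x => ∑ i ∈ s, φ i x :=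
  ContDiff.sum h

lemma torusDeriv_const_mul (c : ℝ) {φ : Torus → ℝ} (hφ : IsC1 φ) (x : Torus) :
    torusDeriv (fun y => c * φ y) x = c * torusDeriv φ x :=
  torusDeriv_eq ((hφ.hasDerivAt x).const_mul c)

lemma torusDeriv_const (c : ℝ) (x : Torus) : torusDeriv (fun _ => c) x = 0 :=
  torusDeriv_eq (hasDerivAt_const _ _)

end TorusCalculus

/-! ### Test functions with finite-rank translates, and their density -/

section FiniteRank

/-- The translates of `η` span a finite-dimensional space of `C¹` functions. -/
def FiniteRankTranslates (η : Torus → ℝ) : Prop :=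
  ∃ (ι : Type) (_ : Fintype ι) (a b : ι → Torus → ℝ), (∀ i, IsC1 (a i)) ∧ (∀ i, IsC1 (b i)) ∧
    ∀ x y, η (y + x) = ∑ i, a i x * b i y

lemma FiniteRankTranslates.add {η ζ : Torus → ℝ} (hη : FiniteRankTranslates η)
    (hζ : FiniteRankTranslates ζ) : FiniteRankTranslates fun x => η x + ζ x := by
  obtain ⟨ι, _, a, b, ha, hb, h⟩ := hη
  obtain ⟨κ, _, c, d, hc, hd, h'⟩ := hζ
  refine ⟨ι ⊕ κ, inferInstance, Sum.elim a c, Sum.elim b d, ?_, ?_, fun x y => ?_⟩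
  · rintro (i | i); exacts [ha i, hc i]
  · rintro (i | i); exacts [hb i, hd i]
  · simp [h, h']

lemma FiniteRankTranslates.mul {η ζ : Torus → ℝ} (hη : FiniteRankTranslates η)
    (hζ : FiniteRankTranslates ζ) : FiniteRankTranslates fun x => η x * ζ x := by
  obtain ⟨ι, _, a, b, ha, hb, h⟩ := hη
  obtain ⟨κ, _, c, d, hc, hd, h'⟩ := hζ
  refine ⟨ι × κ, inferInstance, fun i x => a i.1 x * c i.2 x, fun i x => b i.1 x * d i.2 x,
    fun i => (ha _).mul (hc _), fun i => (hb _).mul (hd _), fun x y => ?_⟩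
  simp only [h, h']
  rw [Finset.sum_mul_sum, Fintype.sum_prod_type]
  exact Finset.sum_congr rfl fun i _ => Finset.sum_congr rfl fun j _ => by ring

lemma finiteRankTranslates_const (c : ℝ) : FiniteRankTranslates fun _ => c :=
  ⟨Unit, inferInstance, fun _ _ => c, fun _ _ => 1, fun _ => isC1_const _, fun _ => isC1_const _,
    by simp⟩

lemma isC1_toCircle_re : IsC1 fun x => (AddCircle.toCircle x : ℂ).re := by
  have : (fun y : ℝ => (AddCircle.toCircle (y : Torus) : ℂ).re)
      = fun y => Real.cos (2 * Real.pi / 1 * y) := by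
    ext y
    rw [AddCircle.toCircle_apply_mk, Circle.coe_exp, Complex.exp_ofReal_mul_I_re]
  rw [IsC1, this]
  fun_prop

lemma isC1_toCircle_im : IsC1 fun x => (AddCircle.toCircle x : ℂ).im := by
  have : (fun y : ℝ => (AddCircle.toCircle (y : Torus) : ℂ).im)
      = fun y => Real.sin (2 * Real.pi / 1 * y) := by
    ext y
    rw [AddCircle.toCircle_apply_mk, Circle.coe_exp, Complex.exp_ofReal_mul_I_im]
  rw [IsC1, this]
  fun_prop

/-- This is the addition formula for the cosine. -/
lemma finiteRankTranslates_toCircle_re :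
    FiniteRankTranslates fun x => (AddCircle.toCircle x : ℂ).re := by
  refine ⟨Bool, inferInstance,
    fun i x => bif i then (AddCircle.toCircle x : ℂ).re else -1 * (AddCircle.toCircle x : ℂ).im,
    fun i x => bif i then (AddCircle.toCircle x : ℂ).re else (AddCircle.toCircle x : ℂ).im,
    ?_, ?_, fun x y => ?_⟩
  · rintro (_ | _); exacts [(isC1_const _).mul isC1_toCircle_im, isC1_toCircle_re]
  · rintro (_ | _); exacts [isC1_toCircle_im, isC1_toCircle_re]
  · simp [AddCircle.toCircle_add]; ring

lemma finiteRankTranslates_toCircle_im :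
    FiniteRankTranslates fun x => (AddCircle.toCircle x : ℂ).im := by
  refine ⟨Bool, inferInstance,
    fun i x => bif i then (AddCircle.toCircle x : ℂ).re else (AddCircle.toCircle x : ℂ).im,
    fun i x => bif i then (AddCircle.toCircle x : ℂ).im else (AddCircle.toCircle x : ℂ).re,
    ?_, ?_, fun x y => ?_⟩
  · rintro (_ | _); exacts [isC1_toCircle_im, isC1_toCircle_re]
  · rintro (_ | _); exacts [isC1_toCircle_re, isC1_toCircle_im]
  · simp [AddCircle.toCircle_add]; ring

lemma FiniteRankTranslates.isC1_translate {η : Torus → ℝ} (h : FiniteRankTranslates η)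
    (x : Torus) : IsC1 fun y => η (y + x) := by
  obtain ⟨ι, _, a, b, -, hb, h⟩ := h
  simp_rw [h]
  exact IsC1.sum fun i _ => (isC1_const _).mul (hb i)

lemma FiniteRankTranslates.isC1 {η : Torus → ℝ} (h : FiniteRankTranslates η) : IsC1 η := by
  simpa using h.isC1_translate 0

/-- The algebra of continuous functions on the torus whose translates span a finite-dimensional
space of `C¹` functions. -/
def finiteRankSubalgebra : Subalgebra ℝ C(Torus, ℝ) where
  carrier := {f | FiniteRankTranslates f}
  mul_mem' ha hb := ha.mul hb
  add_mem' ha hb := ha.add hb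
  algebraMap_mem' c := finiteRankTranslates_const c

lemma separatesPoints_finiteRankSubalgebra : finiteRankSubalgebra.SeparatesPoints := by
  intro x y hxy
  by_contra! hcon
  have hre := hcon _ ⟨⟨_, isC1_toCircle_re.continuous⟩, finiteRankTranslates_toCircle_re, rfl⟩
  have him := hcon _ ⟨⟨_, isC1_toCircle_im.continuous⟩, finiteRankTranslates_toCircle_im, rfl⟩
  exact hxy (AddCircle.injective_toCircle one_ne_zero
    (Circle.ext (Complex.ext hre him)))

/-- A signed measure on the torus is nonnegative on nonnegative continuous functions as soon as it
is so on the squares of functions with translates of finite rank. -/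
lemma integral_nonneg_of_finiteRank {μ : SignedMeasure Torus}
    (h : ∀ η, FiniteRankTranslates η → (∀ x, 0 ≤ η x) → 0 ≤ ∫ᵛ x, η x ∂<•μ)
    {g : Torus → ℝ} (hg : Continuous g) (hg0 : ∀ x, 0 ≤ g x) : 0 ≤ ∫ᵛ x, g x ∂<•μ := by
  -- Approximating `√g` and squaring keeps the approximants of `g` nonnegative and inside the
  -- algebra.
  have hs : Continuous fun x => √(g x) := hg.sqrt
  obtain ⟨M, hM⟩ := isCompact_univ.exists_bound_of_continuousOn hs.continuousOn
  choose P hP using fun n : ℕ => ContinuousMap.exists_mem_subalgebra_near_continuous_of_separatesPoints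
    finiteRankSubalgebra separatesPoints_finiteRankSubalgebra _ hs (1 / ((n : ℝ) + 1))
    Nat.one_div_pos_of_nat
  have hlim : ∀ x, Tendsto (fun n => (P n : C(Torus, ℝ)) x) atTop (𝓝 (√(g x))) := fun x => by
    rw [tendsto_iff_norm_sub_tendsto_zero]
    exact squeeze_zero (fun _ => norm_nonneg _) (fun n => (hP n x).le)
      tendsto_one_div_add_atTop_nhds_zero_nat
  have key : Tendsto (fun n => ∫ᵛ x, (P n : C(Torus, ℝ)) x * (P n : C(Torus, ℝ)) x ∂<•μ) atTop
      (𝓝 (∫ᵛ x, g x ∂<•μ)) := by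
    refine VectorMeasure.tendsto_integral_filter_of_norm_le_const
      (Eventually.of_forall fun n => ?_)
      ⟨(M + 1) * (M + 1), Eventually.of_forall fun n => ae_of_all _ fun x => ?_⟩
      (ae_of_all _ fun x => ?_)
    · exact Continuous.aestronglyMeasurable (by fun_prop)
    · have h1 : ‖(P n : C(Torus, ℝ)) x‖ ≤ M + 1 := by
        have h2 : (1 : ℝ) / ((n : ℝ) + 1) ≤ 1 := by
          rw [div_le_one (by positivity)]; linarith [n.cast_nonneg (α := ℝ)]
        calc ‖(P n : C(Torus, ℝ)) x‖ = ‖√(g x) + ((P n : C(Torus, ℝ)) x - √(g x))‖ := by simp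
          _ ≤ ‖√(g x)‖ + ‖(P n : C(Torus, ℝ)) x - √(g x)‖ := norm_add_le _ _
          _ ≤ M + 1 := add_le_add (hM x trivial) ((hP n x).le.trans h2)
      rw [norm_mul]
      exact mul_self_le_mul_self (norm_nonneg _) h1
    · simpa [Real.mul_self_sqrt (hg0 x)] using (hlim x).mul (hlim x)
  exact ge_of_tendsto' key fun n =>
    h _ ((P n).2.mul (P n).2) fun x => mul_self_nonneg _

end FiniteRank

/-! ### Minimum principle and uniqueness for signed Kac solutions -/

section SignedKac

variable {V lam T : ℝ}

/-- A signed solution of the Kac equation: the weak equation holds from time `0` on, with no sign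
or mass requirement. -/
structure IsSignedKacSol (V lam T : ℝ) (σ : ℝ → SignedMeasure (Omega V)) : Prop where
  intble : ∀ φ : Omega V → ℝ, IsC10 φ →
    IntervalIntegrable (fun r => ∫ᵛ p, kacGen lam φ p ∂<•(σ r)) volume 0 T
  weak : ∀ φ : Omega V → ℝ, IsC10 φ → ∀ t ∈ Icc 0 T,
    ∫ᵛ p, φ p ∂<•(σ t) - ∫ᵛ p, φ p ∂<•(σ 0) = ∫ r in 0..t, ∫ᵛ p, kacGen lam φ p ∂<•(σ r)

lemma IsC10.continuous {φ : Omega V → ℝ} (hφ : IsC10 φ) : Continuous φ :=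
  continuous_omega_iff.2 fun v => (hφ v).continuous

lemma IsC10.continuous_kacGen {φ : Omega V → ℝ} (hφ : IsC10 φ) :
    Continuous (kacGen lam φ) := by
  refine continuous_omega_iff.2 fun v => ?_
  have h1 := (hφ v).continuous_torusDeriv
  have h2 := (hφ v).continuous
  have h3 := (hφ (velNeg v)).continuous
  exact (h1.const_mul (v : ℝ)).add ((h3.sub h2).const_mul lam)

lemma IsSignedKacSol.sub {σ σ' : ℝ → SignedMeasure (Omega V)} (h : IsSignedKacSol V lam T σ)
    (h' : IsSignedKacSol V lam T σ') : IsSignedKacSol V lam T fun t => σ t - σ' t := by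
  have key : ∀ f : Omega V → ℝ, Continuous f → ∀ t, ∫ᵛ p, f p ∂<•(σ t - σ' t)
      = ∫ᵛ p, f p ∂<•(σ t) - ∫ᵛ p, f p ∂<•(σ' t) := fun f hf t =>
    VectorMeasure.integral_sub_vectorMeasure (integrable_of_continuous _ hf)
      (integrable_of_continuous _ hf)
  constructor
  · intro φ hφ
    simp_rw [key _ hφ.continuous_kacGen]
    exact (h.intble φ hφ).sub (h'.intble φ hφ)
  · intro φ hφ t ht
    have hsub : uIcc 0 t ⊆ uIcc 0 T := by
      rw [uIcc_of_le ht.1, uIcc_of_le (ht.1.trans ht.2)]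
      exact Icc_subset_Icc_right ht.2
    simp_rw [key _ hφ.continuous_kacGen, key _ hφ.continuous]
    rw [intervalIntegral.integral_sub ((h.intble φ hφ).mono_set hsub)
      ((h'.intble φ hφ).mono_set hsub), ← h.weak φ hφ t ht, ← h'.weak φ hφ t ht]
    ring

/-- Each moment is a constant plus the primitive of an integrable function. This gives continuity up
to both endpoints, where the flux of an FC solution is not assumed continuous. -/
lemma IsSignedKacSol.continuousOn {σ : ℝ → SignedMeasure (Omega V)}
    (h : IsSignedKacSol V lam T σ) (hT : 0 ≤ T) {φ : Omega V → ℝ} (hφ : IsC10 φ) :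
    ContinuousOn (fun t => ∫ᵛ p, φ p ∂<•(σ t)) (Icc 0 T) := by
  have h1 := intervalIntegral.continuousOn_primitive_interval' (h.intble φ hφ) left_mem_uIcc
  rw [uIcc_of_le hT] at h1
  refine (h1.const_add (∫ᵛ p, φ p ∂<•(σ 0))).congr fun t ht => ?_
  change _ = _ + ∫ r in 0..t, _
  rw [← h.weak φ hφ t ht]
  ring

open Classical in
/-- The test function `g` carried by the single velocity `v`. -/
def onVelocity (v : Velocity V) (g : Torus → ℝ) (p : Omega V) : ℝ := if p.2 = v then g p.1 else 0

lemma isC10_onVelocity (v : Velocity V) {g : Torus → ℝ} (hg : IsC1 g) :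
    IsC10 (onVelocity v g) := by
  intro w
  by_cases h : w = v
  · simpa [onVelocity, h] using hg
  · simpa [onVelocity, h] using isC1_const 0

lemma integral_onVelocity (σ : SignedMeasure (Omega V)) (v : Velocity V) {g : Torus → ℝ}
    (hg : IsC1 g) : ∫ᵛ p, onVelocity v g p ∂<•σ = ∫ᵛ x, g x ∂<•(slice σ v) := by
  rw [integral_eq_sum_slice _ (isC10_onVelocity v hg).continuous, Finset.sum_eq_single v]
  · simp [onVelocity]
  · intro w _ hw
    simp [onVelocity, hw]
  · simp

/-- A test function living on one velocity sees transport and loss on its own slice, and gain from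
the reversed one; this splits the Kac equation into two coupled scalar equations. -/
lemma integral_kacGen_onVelocity (σ : SignedMeasure (Omega V)) (v : Velocity V) {g : Torus → ℝ}
    (hg : IsC1 g) : ∫ᵛ p, kacGen lam (onVelocity v g) p ∂<•σ
      = (v : ℝ) * ∫ᵛ x, torusDeriv g x ∂<•(slice σ v)
        + lam * (∫ᵛ x, g x ∂<•(slice σ (velNeg v)) - ∫ᵛ x, g x ∂<•(slice σ v)) := by
  classical
  have hneg : ∀ w : Velocity V, velNeg w = v ↔ w = velNeg v := fun w =>
    ⟨fun h => by rw [← h, velNeg_velNeg], fun h => by rw [h, velNeg_velNeg]⟩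
  have hgen : ∀ (w : Velocity V) (x : Torus), kacGen lam (onVelocity v g) (x, w)
      = (if w = v then (v : ℝ) else 0) * torusDeriv g x
        + lam * ((if w = velNeg v then 1 else 0) - (if w = v then 1 else 0)) * g x := by
    intro w x
    have h1 : torusDeriv (fun y => onVelocity v g (y, w)) x
        = if w = v then torusDeriv g x else 0 := by
      by_cases h : w = v
      · simp [onVelocity, h]
      · simp [onVelocity, h, torusDeriv_const]
    simp only [kacGen, h1]
    simp only [iota, onVelocity, hneg]
    by_cases h : w = v
    · subst h; simp
      split_ifs <;> ring
    · simp [h]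
  rw [integral_eq_sum_slice _ (isC10_onVelocity v hg).continuous_kacGen]
  have hint : ∀ w : Velocity V, ∫ᵛ x, kacGen lam (onVelocity v g) (x, w) ∂<•(slice σ w)
      = (if w = v then (v : ℝ) else 0) * ∫ᵛ x, torusDeriv g x ∂<•(slice σ w)
        + lam * ((if w = velNeg v then 1 else 0) - (if w = v then 1 else 0))
          * ∫ᵛ x, g x ∂<•(slice σ w) := by
    intro w
    simp_rw [hgen]
    rw [VectorMeasure.integral_fun_add, integral_const_mul_signed, integral_const_mul_signed]
    · exact integrable_of_continuous _ (hg.continuous_torusDeriv.const_mul _)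
    · exact integrable_of_continuous _ (hg.continuous.const_mul _)
  simp_rw [hint, mul_assoc lam, sub_mul, ite_mul, zero_mul, one_mul]
  rw [Finset.sum_add_distrib, ← Finset.mul_sum, Finset.sum_sub_distrib]
  simp

/-- Minimum principle for the moments of a signed solution along the translates of a test function
with finite rank translates. -/
lemma IsSignedKacSol.integral_slice_nonneg {σ : ℝ → SignedMeasure (Omega V)}
    (h : IsSignedKacSol V lam T σ) (hlam : 0 ≤ lam) (hT : 0 ≤ T) (h0 : 0 ≤ σ 0)
    {η : Torus → ℝ} (hη : FiniteRankTranslates η) (hη0 : ∀ x, 0 ≤ η x) {t : ℝ}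
    (ht : t ∈ Icc 0 T) (v : Velocity V) : 0 ≤ ∫ᵛ x, η x ∂<•(slice (σ t) v) := by
  have hC1 := hη.isC1_translate
  obtain ⟨ι, _, a, b, ha, hb, hab⟩ := hη
  -- The variables separate: all time dependence of `f` sits in the finitely many moments `m`, all
  -- space dependence in the `C¹` functions `a i`.
  let m : ι → Velocity V → ℝ → ℝ := fun i v t => ∫ᵛ y, b i y ∂<•(slice (σ t) v)
  let f : ℝ → Torus → Velocity V → ℝ := fun t x v => ∑ i, a i x * m i v t
  let f' : ℝ → Torus → Velocity V → ℝ := fun t x v => ∑ i, torusDeriv (a i) x * m i v t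
  have hm : ∀ i v, ContinuousOn (m i v) (Icc 0 T) := fun i v => by
    simpa only [integral_onVelocity _ v (hb i)] using
      h.continuousOn hT (isC10_onVelocity v (hb i))
  have hfη : ∀ t x v, ∫ᵛ y, η (y + x) ∂<•(slice (σ t) v) = f t x v := by
    intro t x v
    simp_rw [hab]
    rw [VectorMeasure.integral_finsetSum]
    · exact Finset.sum_congr rfl fun i _ => integral_const_mul_signed _ _ _
    · exact fun i _ => integrable_of_continuous _ ((hb i).continuous.const_mul _)
  have hη' : ∀ x y, torusDeriv (fun y => η (y + x)) y = ∑ i, torusDeriv (a i) x * b i y := by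
    intro x y
    refine torusDeriv_eq ?_
    have heq : (fun s : ℝ => η (y + (s : Torus) + x))
        = fun s : ℝ => ∑ i, a i (x + (s : Torus)) * b i y := by
      ext s
      rw [add_assoc, add_comm (s : Torus) x, hab]
    rw [heq]
    exact HasDerivAt.fun_sum fun i _ => ((ha i).hasDerivAt x).mul_const _
  have hfη' : ∀ t x v, ∫ᵛ y, torusDeriv (fun y => η (y + x)) y ∂<•(slice (σ t) v) = f' t x v := by
    intro t x v
    simp_rw [hη']
    rw [VectorMeasure.integral_finsetSum]
    · exact Finset.sum_congr rfl fun i _ => integral_const_mul_signed _ _ _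
    · exact fun i _ => integrable_of_continuous _ ((hb i).continuous.const_mul _)
  have hfder : ∀ t x v, HasDerivAt (fun s : ℝ => f t (x + (s : Torus)) v) (f' t x v) 0 :=
    fun t x v => HasDerivAt.fun_sum fun i _ => ((ha i).hasDerivAt x).mul_const _
  let G : Torus → Velocity V → ℝ → ℝ := fun x v r =>
    (v : ℝ) * f' r x v + lam * (f r x (velNeg v) - f r x v)
  have hG : ∀ x v, ContinuousOn (G x v) (Icc 0 T) := by
    intro x v
    have h1 := hm
    simp only [G, f, f']
    fun_prop
  have hweak : ∀ x v, ∀ t ∈ Icc 0 T, f t x v - f 0 x v = ∫ r in 0..t, G x v r := by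
    intro x v t ht
    have := h.weak _ (isC10_onVelocity v (hC1 x)) t ht
    simpa only [integral_onVelocity _ v (hC1 x), integral_kacGen_onVelocity _ v (hC1 x), hfη,
      hfη'] using this
  have hGint : ∀ x v, ∀ s ∈ Icc 0 T, ∀ t ∈ Icc 0 T, IntervalIntegrable (G x v) volume s t :=
    fun x v s hs t ht => ((hG x v).mono (by
      rw [← uIcc_of_le hT] at hs ht ⊢
      exact uIcc_subset_uIcc hs ht)).intervalIntegrable
  have hf0 : ∀ x v, 0 ≤ f 0 x v := fun x v => by
    rw [← hfη]
    exact integral_nonneg_of_nonneg (slice_nonneg h0 v) fun y => hη0 _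
  -- The term `ε t` makes the inequality at the minimum strict, so that a minimum at a positive time
  -- is impossible.
  have key : ∀ ε > 0, ∀ t ∈ Icc 0 T, ∀ x v, 0 ≤ f t x v + ε * t := by
    intro ε hε
    let K : Set (ℝ × Torus × Velocity V) := Icc 0 T ×ˢ univ
    have hKc : IsCompact K := isCompact_Icc.prod isCompact_univ
    have hKn : K.Nonempty := ⟨(0, 0, v), ⟨le_rfl, hT⟩, trivial⟩
    let F : ℝ × Torus × Velocity V → ℝ := fun q => f q.1 q.2.1 q.2.2 + ε * q.1
    have hF : ContinuousOn F K := by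
      -- Velocities are discrete, so near `q` the velocity is frozen and only continuity in time is
      -- needed.
      have hm' : ∀ i, ContinuousOn (fun q : ℝ × Torus × Velocity V => m i q.2.2 q.1) K := by
        intro i q hq
        have h1 : ContinuousWithinAt (fun q' : ℝ × Torus × Velocity V => m i q.2.2 q'.1) K q :=
          ((hm i q.2.2).comp continuousOn_fst fun q hq => hq.1) q hq
        have h2 : {q' : ℝ × Torus × Velocity V | q'.2.2 = q.2.2} ∈ 𝓝 q :=
          (isOpen_discrete {q.2.2}).preimage (continuous_snd.comp continuous_snd) |>.mem_nhds rfl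
        refine h1.congr_of_eventuallyEq ?_ rfl
        filter_upwards [mem_nhdsWithin_of_mem_nhds h2] with q' hq'
        have hv : q'.2.2 = q.2.2 := hq'
        rw [hv]
      have ha' : ∀ i, Continuous (a i) := fun i => (ha i).continuous
      exact (continuousOn_finsetSum _ fun i _ =>
        ((ha' i).comp (continuous_fst.comp continuous_snd)).continuousOn.mul (hm' i)).add
        (continuous_fst.const_mul ε).continuousOn
    obtain ⟨⟨t₀, x₀, v₀⟩, hq, hmin⟩ := hKc.exists_isMinOn hKn hF
    have ht₀ : t₀ ∈ Icc 0 T := hq.1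
    have hmin' : ∀ t ∈ Icc 0 T, ∀ x v, f t₀ x₀ v₀ + ε * t₀ ≤ f t x v + ε * t := fun t ht x v =>
      hmin (show (t, x, v) ∈ K from ⟨ht, trivial⟩)
    suffices hpos : 0 ≤ f t₀ x₀ v₀ + ε * t₀ from
      fun t ht x v => hpos.trans (hmin' t ht x v)
    rcases ht₀.1.eq_or_lt with h00 | h00
    · rw [← h00]; simpa using hf0 x₀ v₀
    exfalso
    have hder0 : f' t₀ x₀ v₀ = 0 := by
      refine IsLocalMin.hasDerivAt_eq_zero (Eventually.of_forall fun s => ?_) (hfder t₀ x₀ v₀)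
      simpa using hmin' t₀ ht₀ (x₀ + (s : Torus)) v₀
    -- At the minimum the space derivative vanishes, and the reversed velocity has a value at least
    -- as large, so the collision term is nonnegative.
    have hG0 : 0 ≤ G x₀ v₀ t₀ := by
      have h1 : f t₀ x₀ v₀ ≤ f t₀ x₀ (velNeg v₀) := by
        simpa using hmin' t₀ ht₀ x₀ (velNeg v₀)
      simp only [G, hder0, mul_zero, zero_add]
      exact mul_nonneg hlam (sub_nonneg.2 h1)
    -- Just before `t₀` the rate of `f + ε t` is positive, so this quantity was strictly smaller at
    -- an earlier time `s`, contradicting minimality. Only the integrated equation is used, and `t₀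
    -- = T` is covered.
    have hev : ∀ᶠ r in 𝓝[Icc 0 T] t₀, -ε < G x₀ v₀ r :=
      (hG x₀ v₀ t₀ ht₀).eventually (lt_mem_nhds (by linarith))
    obtain ⟨δ, hδ, hball⟩ := Metric.mem_nhdsWithin_iff.1 hev
    obtain ⟨s, hs1, hs2⟩ := exists_between (max_lt h00 (sub_lt_self t₀ hδ))
    have hs0 : 0 < s := (le_max_left _ _).trans_lt hs1
    have hsδ : t₀ - δ < s := (le_max_right _ _).trans_lt hs1
    have hsT : s ∈ Icc 0 T := ⟨hs0.le, hs2.le.trans ht₀.2⟩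
    have hint : f t₀ x₀ v₀ - f s x₀ v₀ = ∫ r in s..t₀, G x₀ v₀ r := by
      have h1 := hweak x₀ v₀ t₀ ht₀
      have h2 := hweak x₀ v₀ s hsT
      have h3 := intervalIntegral.integral_add_adjacent_intervals
        (hGint x₀ v₀ 0 ⟨le_rfl, hT⟩ s hsT) (hGint x₀ v₀ s hsT t₀ ht₀)
      linarith
    have hlt : 0 < ∫ r in s..t₀, (G x₀ v₀ r + ε) := by
      refine intervalIntegral.intervalIntegral_pos_of_pos_on
        ((hGint x₀ v₀ s hsT t₀ ht₀).add intervalIntegrable_const) (fun r hr => ?_) hs2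
      have : -ε < G x₀ v₀ r := hball ⟨by
        rw [Metric.mem_ball, Real.dist_eq, abs_lt]; constructor <;> linarith [hr.1, hr.2],
        hs0.le.trans hr.1.le, hr.2.le.trans ht₀.2⟩
      linarith
    rw [intervalIntegral.integral_add (hGint x₀ v₀ s hsT t₀ ht₀) intervalIntegrable_const,
      ← hint, intervalIntegral.integral_const, smul_eq_mul] at hlt
    have := hmin' s hsT x₀ v₀
    nlinarith
  have hlim : 0 ≤ f t 0 v := by
    refine le_of_forall_pos_le_add fun ε hε => ?_
    have h1 := key (ε / (T + 1)) (by positivity) t ht 0 v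
    have h2 : ε / (T + 1) * t ≤ ε := by
      rw [div_mul_eq_mul_div, div_le_iff₀ (by positivity)]
      nlinarith [ht.2]
    linarith
  simpa [← hfη] using hlim

/-- A signed solution of the Kac equation with nonnegative initial datum stays nonnegative. -/
lemma IsSignedKacSol.nonneg {σ : ℝ → SignedMeasure (Omega V)}
    (h : IsSignedKacSol V lam T σ) (hlam : 0 ≤ lam) (hT : 0 ≤ T) (h0 : 0 ≤ σ 0) {t : ℝ}
    (ht : t ∈ Icc 0 T) : 0 ≤ σ t := by
  refine nonneg_of_forall_integral_nonneg fun φ hφ hφ0 => ?_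
  rw [integral_eq_sum_slice _ hφ]
  exact Finset.sum_nonneg fun v _ => integral_nonneg_of_finiteRank
    (fun η hη hη0 => h.integral_slice_nonneg hlam hT h0 hη hη0 ht v)
    (continuous_omega_iff.1 hφ v) fun x => hφ0 _

/-- Signed solutions of the Kac equation are determined by their initial datum. -/
lemma IsSignedKacSol.eqOn {σ σ' : ℝ → SignedMeasure (Omega V)}
    (h : IsSignedKacSol V lam T σ) (h' : IsSignedKacSol V lam T σ') (hlam : 0 ≤ lam)
    (hT : 0 ≤ T) (h0 : σ 0 = σ' 0) : EqOn σ σ' (Icc 0 T) := fun t ht =>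
  -- Both differences are signed solutions with zero initial datum, hence both are nonnegative.
  le_antisymm
    (sub_nonneg.1 ((h'.sub h).nonneg hlam hT (by simp [h0]) ht))
    (sub_nonneg.1 ((h.sub h').nonneg hlam hT (by simp [h0]) ht))

end SignedKac

/-! ### Passing between the Kac equation and the FC system -/

section Equivalence

variable {V lam T : ℝ}

lemma NarrowContinuousOn.continuousOn_integral {X : Type*} [MeasurableSpace X]
    [TopologicalSpace X] [CompactSpace X] {μ : ℝ → SignedMeasure X} {I : Set ℝ}
    (h : NarrowContinuousOn μ I) {f : X → ℝ} (hf : Continuous f) :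
    ContinuousOn (fun t => ∫ᵛ x, f x ∂<•(μ t)) I :=
  h (BoundedContinuousFunction.mkOfCompact ⟨f, hf⟩)

lemma intervalIntegrable_of_continuousOn_Icc {u : ℝ → ℝ} (hu : ContinuousOn u (Icc 0 T)) {s t : ℝ}
    (hs : 0 ≤ s) (hst : s ≤ t) (ht : t ≤ T) : IntervalIntegrable u volume s t :=
  (hu.mono (by rw [uIcc_of_le hst]; exact Icc_subset_Icc hs ht)).intervalIntegrable

lemma IsKacWeakSol.isSignedKacSol {σ₀ : SignedMeasure (Omega V)}
    {σ : ℝ → SignedMeasure (Omega V)} (h : IsKacWeakSol V lam T σ₀ σ) (hT : 0 ≤ T) :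
    IsSignedKacSol V lam T σ where
  intble _ hφ := intervalIntegrable_of_continuousOn_Icc
    (h.cont.continuousOn_integral hφ.continuous_kacGen) le_rfl hT le_rfl
  weak φ hφ t ht := h.weak φ hφ 0 t le_rfl ht.1 ht.2

/-- Narrow continuity on the open interval gives measurability, and the integrable total variation
of `λ ω` dominates; dividing by `λ > 0` removes the factor. -/
lemma IsMomentumSol.intervalIntegrable_integral_source {ρ ω : ℝ → SignedMeasure Torus}
    (h : IsMomentumSol V T ρ ω fun t => lam • ω t) (hlam : 0 < lam) (hT : 0 ≤ T)
    {ψ : Torus → ℝ} (hψ : Continuous ψ) :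
    IntervalIntegrable (fun r => ∫ᵛ x, ψ x ∂<•(ω r)) volume 0 T := by
  suffices hK : IntervalIntegrable (fun r => ∫ᵛ x, ψ x ∂<•(lam • ω r)) volume 0 T by
    refine (hK.const_mul lam⁻¹).congr fun r _ => ?_
    rw [VectorMeasure.integral_smul_vectorMeasure, smul_eq_mul, inv_mul_cancel_left₀ hlam.ne']
  obtain ⟨C, hC⟩ := isCompact_univ.exists_bound_of_continuousOn hψ.continuousOn
  have hC' : ∀ x, ‖ψ x‖ₑ ≤ ENNReal.ofReal C := fun x => by
    rw [← ofReal_norm]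
    exact ENNReal.ofReal_le_ofReal (hC x trivial)
  rw [intervalIntegrable_iff_integrableOn_Ioo_of_le hT]
  refine ⟨?_, ?_⟩
  · simp_rw [VectorMeasure.integral_smul_vectorMeasure]
    exact ((h.cont_flux.continuousOn_integral hψ).const_smul lam).aestronglyMeasurable
      measurableSet_Ioo
  · have hle : ∀ r, ‖∫ᵛ x, ψ x ∂<•(lam • ω r)‖ₑ
        ≤ ENNReal.ofReal C * ‖(ContinuousLinearMap.lsmul ℝ ℝ (E := ℝ)).flip‖ₑ
          * tvNorm (lam • ω r) := fun r =>
      VectorMeasure.enorm_integral_le_of_enorm_le_const (ae_of_all _ hC')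
    refine (lintegral_mono hle).trans_lt ?_
    rw [lintegral_const_mul' _ _ (by finiteness)]
    exact ENNReal.mul_lt_top (by finiteness) h.tv

/-- Summed over `v`, the reversal terms cancel against `ρ` and double against `ω / v`, while `v = V²
/ v` puts transport in the form of the FC right-hand sides. -/
lemma integral_kacGen_projInv (hV : 0 < V) (ρ ω : SignedMeasure Torus) {φ : Omega V → ℝ}
    (hφ : IsC10 φ) : ∫ᵛ p, kacGen lam φ p ∂<•(projInv V (ρ, ω)) = ∑ v : Velocity V,
      (1 / 2 : ℝ) * (∫ᵛ x, torusDeriv (fun y => φ (y, v)) x ∂<•ω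
        + 1 / (v : ℝ) * (V ^ 2 * ∫ᵛ x, torusDeriv (fun y => φ (y, v)) x ∂<•ρ
          - 2 * (lam * ∫ᵛ x, φ (x, v) ∂<•ω))) := by
  have hint : ∀ (μ : SignedMeasure Torus) (v : Velocity V), ∫ᵛ x, kacGen lam φ (x, v) ∂<•μ
      = (v : ℝ) * ∫ᵛ x, torusDeriv (fun y => φ (y, v)) x ∂<•μ
        + lam * (∫ᵛ x, φ (x, velNeg v) ∂<•μ - ∫ᵛ x, φ (x, v) ∂<•μ) := by
    intro μ v
    have h1 := integrable_of_continuous μ ((hφ v).continuous_torusDeriv.const_mul (v : ℝ))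
    have h2 := (hφ v).continuous
    have h3 := (hφ (velNeg v)).continuous
    have h4 : μ.Integrable fun x => lam * (φ (x, velNeg v) - φ (x, v)) :=
      integrable_of_continuous μ ((h3.sub h2).const_mul lam)
    simp only [kacGen, iota]
    rw [VectorMeasure.integral_fun_add h1 h4, integral_const_mul_signed, integral_const_mul_signed]
    congr 2
    exact VectorMeasure.integral_fun_sub (integrable_of_continuous _ h3)
      (integrable_of_continuous _ h2)
  have hP : velNeg (⟨V, by simp⟩ : Velocity V) = ⟨-V, by simp⟩ := rfl
  have hM : velNeg (⟨-V, by simp⟩ : Velocity V) = ⟨V, by simp⟩ := Subtype.ext (neg_neg V)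
  rw [integral_projInv _ hφ.continuous_kacGen]
  simp only [hint, sum_velocity hV, hP, hM]
  field_simp
  ring

lemma IsFCWeakSol.isSignedKacSol {ρ₀ ω₀ : SignedMeasure Torus} {ρ ω : ℝ → SignedMeasure Torus}
    (h : IsFCWeakSol V lam T ρ₀ ω₀ ρ ω) (hV : 0 < V) (hlam : 0 < lam) (hT : 0 ≤ T) :
    IsSignedKacSol V lam T fun t => projInv V (ρ t, ω t) := by
  have hm := h.momentum
  have i1 : ∀ {φ : Omega V → ℝ}, IsC10 φ → ∀ v : Velocity V, IntervalIntegrable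
      (fun r => ∫ᵛ x, torusDeriv (fun y => φ (y, v)) x ∂<•(ω r)) volume 0 T :=
    fun hφ v => hm.intble _ (hφ v)
  have i2 : ∀ {φ : Omega V → ℝ}, IsC10 φ → ∀ v : Velocity V, IntervalIntegrable
      (fun r => V ^ 2 * ∫ᵛ x, torusDeriv (fun y => φ (y, v)) x ∂<•(ρ r)) volume 0 T :=
    fun hφ v => (intervalIntegrable_of_continuousOn_Icc
      (hm.cont_density.continuousOn_integral (hφ v).continuous_torusDeriv)
      le_rfl hT le_rfl).const_mul _
  have i3 : ∀ {φ : Omega V → ℝ}, IsC10 φ → ∀ v : Velocity V, IntervalIntegrable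
      (fun r => 2 * (lam * ∫ᵛ x, φ (x, v) ∂<•(ω r))) volume 0 T :=
    fun hφ v => ((hm.intervalIntegrable_integral_source hlam hT
      (hφ v).continuous).const_mul _).const_mul _
  constructor
  · intro φ hφ
    simp_rw [integral_kacGen_projInv hV _ _ hφ, sum_velocity hV]
    have key := fun v => ((i1 hφ v).add
      (((i2 hφ v).sub (i3 hφ v)).const_mul (1 / (v : ℝ)))).const_mul (1 / 2)
    exact (key _).add (key _)
  · intro φ hφ t ht
    have hsub : uIcc 0 t ⊆ uIcc 0 T := by
      rw [uIcc_of_le ht.1, uIcc_of_le (ht.1.trans ht.2)]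
      exact Icc_subset_Icc_right ht.2
    have j1 := fun v => (i1 hφ v).mono_set hsub
    have j2 := fun v => (i2 hφ v).mono_set hsub
    have j3 := fun v => (i3 hφ v).mono_set hsub
    simp_rw [integral_kacGen_projInv hV _ _ hφ, integral_projInv _ hφ.continuous]
    rw [intervalIntegral.integral_finsetSum fun v _ =>
      ((j1 v).add (((j2 v).sub (j3 v)).const_mul (1 / (v : ℝ)))).const_mul (1 / 2),
      ← Finset.sum_sub_distrib]
    refine Finset.sum_congr rfl fun v _ => ?_
    have e1 := hm.weak_density _ (hφ v) 0 t le_rfl ht.1 ht.2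
    have e2 := hm.weak_flux _ (hφ v) 0 t le_rfl ht.1 ht.2
    simp_rw [VectorMeasure.integral_smul_vectorMeasure, smul_eq_mul] at e2
    rw [intervalIntegral.integral_const_mul,
      intervalIntegral.integral_add (j1 v) (((j2 v).sub (j3 v)).const_mul _),
      intervalIntegral.integral_const_mul, intervalIntegral.integral_sub (j2 v) (j3 v),
      intervalIntegral.integral_const_mul, intervalIntegral.integral_const_mul 2, ← e1, ← e2]
    ring

lemma proj_fst_univ (j : SignedMeasure (Omega V)) : (proj j).1 univ = j univ := by
  rw [← integral_one, ← integral_one, integral_proj_fst j continuous_const]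

lemma IsProb.proj {j : SignedMeasure (Omega V)} (h : IsProb j) : IsProb (proj j).1 :=
  ⟨Finset.sum_nonneg fun v _ => slice_nonneg h.1 v, (proj_fst_univ j).trans h.2⟩

lemma slice_univ_le {j : SignedMeasure (Omega V)} (h : IsProb j) (v : Velocity V) :
    slice j v univ ≤ 1 := by
  refine le_of_le_of_eq ?_ ((proj_fst_univ j).trans h.2)
  simp only [proj, FunLike.coe_sum, Finset.sum_apply]
  exact Finset.single_le_sum (f := fun w => slice j w univ)
    (fun w _ => slice_nonneg h.1 w _ MeasurableSet.univ) (Finset.mem_univ v)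

lemma tvNorm_smul_proj_snd_le {j : SignedMeasure (Omega V)} (h : IsProb j) (c : ℝ) :
    tvNorm (c • (proj j).2) ≤ ‖c‖ₑ * ∑ v : Velocity V, ‖(v : ℝ)‖ₑ := by
  have h1 : ((proj j).2).variation ≤ ∑ v : Velocity V, ((v : ℝ) • slice j v).variation :=
    VectorMeasure.variation_finsetSum_le _ _
  rw [tvNorm, VectorMeasure.variation_smul, Measure.smul_apply]
  refine mul_le_mul_right ((h1 univ).trans ?_) _
  rw [Measure.finsetSum_apply]
  refine Finset.sum_le_sum fun v _ => ?_
  rw [VectorMeasure.variation_smul, Measure.smul_apply,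
    variation_univ_of_nonneg (slice_nonneg h.1 v)]
  refine (mul_le_mul_right (ENNReal.ofReal_le_one.2 (slice_univ_le h v)) _).trans_eq ?_
  exact mul_one _

lemma kacGen_comp_fst {φ : Torus → ℝ} (p : Omega V) :
    kacGen lam (fun p : Omega V => φ p.1) p = (p.2 : ℝ) * torusDeriv φ p.1 := by
  simp [kacGen, iota]

/-- The factor `v` is odd under reversal, hence the damping rate `2λ`; and `v² = V²` closes the
system at the second moment. -/
lemma kacGen_velocity_mul {ψ : Torus → ℝ} (hψ : IsC1 ψ) (p : Omega V) :
    kacGen lam (fun p : Omega V => (p.2 : ℝ) * ψ p.1) p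
      = V ^ 2 * torusDeriv ψ p.1 - 2 * lam * ((p.2 : ℝ) * ψ p.1) := by
  simp only [kacGen, iota, torusDeriv_const_mul _ hψ, coe_velNeg]
  rw [← mul_assoc, velocity_sq]
  ring

lemma IsKacWeakSol.isFCWeakSol {σ₀ : SignedMeasure (Omega V)} {σ : ℝ → SignedMeasure (Omega V)}
    (h : IsKacWeakSol V lam T σ₀ σ) (hT : 0 ≤ T) :
    IsFCWeakSol V lam T (proj σ₀).1 (proj σ₀).2 (fun t => (proj (σ t)).1)
      (fun t => (proj (σ t)).2) := by
  have c1 : ∀ {f : Torus → ℝ}, Continuous f →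
      ContinuousOn (fun t => ∫ᵛ x, f x ∂<•(proj (σ t)).1) (Icc 0 T) := fun hf => by
    simp_rw [integral_proj_fst _ hf]
    exact h.cont.continuousOn_integral (by fun_prop)
  have c2 : ∀ {f : Torus → ℝ}, Continuous f →
      ContinuousOn (fun t => ∫ᵛ x, f x ∂<•(proj (σ t)).2) (Icc 0 T) := fun hf => by
    simp_rw [integral_proj_snd _ hf]
    exact h.cont.continuousOn_integral (by fun_prop)
  refine ⟨⟨fun t ht => (h.prob t ht).proj, fun f => c1 f.continuous,
    fun f => (c2 f.continuous).mono Ioo_subset_Icc_self,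
    measurableFamily_of_narrowContinuousOn fun f => ?_, ?_, fun φ hφ =>
    intervalIntegrable_of_continuousOn_Icc (c2 hφ.continuous_torusDeriv) le_rfl hT le_rfl,
    ?_, ?_⟩, by simp only [h.init], by simp only [h.init]⟩
  · simp_rw [VectorMeasure.integral_smul_vectorMeasure]
    exact ((c2 f.continuous).mono Ioo_subset_Icc_self).const_smul lam
  · refine (setLIntegral_mono measurable_const fun t ht =>
      tvNorm_smul_proj_snd_le (h.prob t (Ioo_subset_Icc_self ht)) lam).trans_lt ?_
    rw [setLIntegral_const]
    refine ENNReal.mul_lt_top (ENNReal.mul_lt_top (by finiteness) ?_) (by simp)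
    exact ENNReal.sum_lt_top.2 fun v _ => by finiteness
  · intro φ hφ s t hs hst ht
    have hw := h.weak (fun p => φ p.1) (fun v => hφ) s t hs hst ht
    simp_rw [kacGen_comp_fst] at hw
    simp_rw [integral_proj_fst _ hφ.continuous, integral_proj_snd _ hφ.continuous_torusDeriv]
    exact hw
  · intro ψ hψ s t hs hst ht
    have hw := h.weak (fun p => (p.2 : ℝ) * ψ p.1) (fun v => (isC1_const (v : ℝ)).mul hψ)
      s t hs hst ht
    have e : ∀ r, ∫ᵛ p, kacGen lam (fun p : Omega V => (p.2 : ℝ) * ψ p.1) p ∂<•(σ r)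
        = V ^ 2 * ∫ᵛ x, torusDeriv ψ x ∂<•(proj (σ r)).1
          - 2 * ∫ᵛ x, ψ x ∂<•(lam • (proj (σ r)).2) := by
      intro r
      have k1 := hψ.continuous
      have k2 := hψ.continuous_torusDeriv
      simp_rw [kacGen_velocity_mul hψ]
      rw [VectorMeasure.integral_fun_sub (integrable_of_continuous _ (by fun_prop))
        (integrable_of_continuous _ (by fun_prop)), integral_const_mul_signed,
        integral_const_mul_signed, VectorMeasure.integral_smul_vectorMeasure,
        integral_proj_fst _ k2, integral_proj_snd _ k1, smul_eq_mul, mul_assoc]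
    simp_rw [e] at hw
    simp_rw [integral_proj_snd _ hψ.continuous]
    rw [hw, intervalIntegral.integral_sub, intervalIntegral.integral_const_mul,
      intervalIntegral.integral_const_mul]
    · exact (intervalIntegrable_of_continuousOn_Icc (c1 hψ.continuous_torusDeriv)
        hs hst ht).const_mul _
    · simp_rw [VectorMeasure.integral_smul_vectorMeasure]
      exact ((intervalIntegrable_of_continuousOn_Icc (c2 hψ.continuous)
        hs hst ht).smul lam).const_mul _

lemma projInv_nonneg {J : SignedMeasure Torus × SignedMeasure Torus}
    (hV : 0 < V) (h1 : -(V • J.1) ≤ J.2) (h2 : J.2 ≤ V • J.1) : 0 ≤ projInv V J := by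
  intro B hB
  simp only [projInv, FunLike.coe_sum, Finset.sum_apply]
  refine Finset.sum_nonneg fun v _ => ?_
  have hm := (measurableEmbedding_slice v).measurable hB
  rw [VectorMeasure.map_apply _ (measurableEmbedding_slice v).measurable hB]
  have k1 := h1 _ hm
  have k2 := h2 _ hm
  simp only [FunLike.coe_smul, FunLike.coe_add, FunLike.coe_neg, Pi.smul_apply, Pi.add_apply,
    Pi.neg_apply, smul_eq_mul] at k1 k2 ⊢
  refine mul_nonneg (by norm_num) ?_
  rcases v.2 with h | h
  · have : 1 / (v : ℝ) = -(1 / V) := by rw [h]; ring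
    rw [this]
    have := mul_le_mul_of_nonneg_left k2 (one_div_pos.2 hV).le
    rw [one_div, inv_mul_cancel_left₀ hV.ne'] at this
    rw [one_div]; linarith
  · rw [show (v : ℝ) = V from h]
    have := mul_le_mul_of_nonneg_left k1 (one_div_pos.2 hV).le
    rw [one_div, mul_neg, inv_mul_cancel_left₀ hV.ne'] at this
    rw [one_div]; linarith

/-- A signed solution of the Kac equation consisting of probability measures is a narrowly
continuous curve. -/
lemma IsSignedKacSol.narrowContinuousOn {σ : ℝ → SignedMeasure (Omega V)}
    (h : IsSignedKacSol V lam T σ) (hT : 0 ≤ T) (hp : ∀ t ∈ Icc 0 T, IsProb (σ t)) :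
    NarrowContinuousOn σ (Icc 0 T) := by
  intro f
  -- The `C¹` moments are already continuous. Since every `σ t` has mass one, approximating `f`
  -- within `ε / 2` on each velocity changes its integral by less than `ε`, uniformly in time.
  refine continuousOn_of_uniform_approx_of_continuousOn fun u hu => ?_
  obtain ⟨ε, hε, hu⟩ := Metric.mem_uniformity_dist.1 hu
  have hfv : ∀ v : Velocity V, Continuous fun x => f (x, v) := fun v =>
    continuous_omega_iff.1 f.continuous v
  choose P hP using fun v : Velocity V =>
    ContinuousMap.exists_mem_subalgebra_near_continuous_of_separatesPoints
      finiteRankSubalgebra separatesPoints_finiteRankSubalgebra _ (hfv v) (ε / 2) (half_pos hε)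
  let φ : Omega V → ℝ := fun p => (P p.2 : C(Torus, ℝ)) p.1
  have hφ : IsC10 φ := fun v => FiniteRankTranslates.isC1 (P v).2
  refine ⟨_, h.continuousOn hT hφ, fun t ht => hu ?_⟩
  rw [Real.dist_eq, ← VectorMeasure.integral_fun_sub
    (integrable_of_continuous _ f.continuous) (integrable_of_continuous _ hφ.continuous)]
  refine (abs_integral_le (half_pos hε).le fun p => ?_).trans_lt
    (b := ε / 2 * (σ t).variation.real univ) ?_
  · rw [abs_sub_comm]
    exact (hP p.2 p.1).le
  · rw [Measure.real, variation_univ_of_nonneg (hp t ht).1, (hp t ht).2]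
    simpa using half_lt_self hε

lemma IsFCWeakSol.isKacWeakSol {ρ₀ ω₀ : SignedMeasure Torus} {ρ ω : ℝ → SignedMeasure Torus}
    (h : IsFCWeakSol V lam T ρ₀ ω₀ ρ ω) (hV : 0 < V) (hlam : 0 < lam) (hT : 0 ≤ T)
    (h1 : -(V • ρ₀) ≤ ω₀) (h2 : ω₀ ≤ V • ρ₀) :
    IsKacWeakSol V lam T (projInv V (ρ₀, ω₀)) fun t => projInv V (ρ t, ω t) := by
  have hs := h.isSignedKacSol hV hlam hT
  have h0 : (0 : SignedMeasure (Omega V)) ≤ projInv V (ρ 0, ω 0) := by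
    rw [h.init_density, h.init_flux]
    exact projInv_nonneg hV h1 h2
  -- The bounds on the flux are known only at time `0`; the minimum principle propagates them as
  -- positivity. The mass is that of `ρ t`.
  have hp : ∀ t ∈ Icc 0 T, IsProb (projInv V (ρ t, ω t)) := fun t ht =>
    ⟨hs.nonneg hlam.le hT h0 ht, by
      rw [← proj_fst_univ, proj_projInv hV]
      exact (h.momentum.prob t ht).2⟩
  refine ⟨hp, hs.narrowContinuousOn hT hp, by simp only [h.init_density, h.init_flux],
    fun φ hφ s t h0s hst htT => ?_⟩
  have e1 := hs.weak φ hφ s ⟨h0s, hst.trans htT⟩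
  have e2 := hs.weak φ hφ t ⟨h0s.trans hst, htT⟩
  have hmono : ∀ {a b : ℝ}, a ∈ Icc 0 T → b ∈ Icc 0 T → uIcc a b ⊆ uIcc 0 T := by
    intro a b ha hb
    rw [← uIcc_of_le hT] at ha hb
    exact uIcc_subset_uIcc ha hb
  have e3 := intervalIntegral.integral_add_adjacent_intervals
    ((hs.intble φ hφ).mono_set (hmono ⟨le_rfl, hT⟩ ⟨h0s, hst.trans htT⟩))
    ((hs.intble φ hφ).mono_set (hmono ⟨h0s, hst.trans htT⟩ ⟨h0s.trans hst, htT⟩))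
  linarith

end Equivalence

end KacFC
end

theorem theorem2p8 (V lam T : ℝ) (hV : 0 < V) (hlam : 0 < lam) (hT : 0 < T) :
    (∀ (σ₀ : MeasureTheory.SignedMeasure (KacFC.Omega V))
        (σ : ℝ → MeasureTheory.SignedMeasure (KacFC.Omega V)),
      KacFC.IsProb σ₀ →
      KacFC.IsKacWeakSol V lam T σ₀ σ →
      KacFC.IsTheFCWeakSol V lam T (KacFC.proj σ₀).1 (KacFC.proj σ₀).2
        (fun t => (KacFC.proj (σ t)).1) (fun t => (KacFC.proj (σ t)).2)) ∧
    (∀ (ρ₀ ω₀ : MeasureTheory.SignedMeasure KacFC.Torus)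
        (ρ ω : ℝ → MeasureTheory.SignedMeasure KacFC.Torus),
      KacFC.IsProb ρ₀ →
      -(V • ρ₀) ≤ ω₀ → ω₀ ≤ V • ρ₀ →
      KacFC.IsFCWeakSol V lam T ρ₀ ω₀ ρ ω →
      KacFC.IsTheKacWeakSol V lam T (KacFC.projInv V (ρ₀, ω₀))
        (fun t => KacFC.projInv V (ρ t, ω t))) := by
  refine ⟨fun σ₀ σ _ h => ⟨h.isFCWeakSol hT.le, fun ρ' ω' h' => ?_⟩,
    fun ρ₀ ω₀ ρ ω _ h1 h2 h => ⟨h.isKacWeakSol hV hlam hT.le h1 h2, fun σ' h' => ?_⟩⟩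
  -- The competing FC solution is compared with `σ` on the Kac side, where uniqueness holds among
  -- signed solutions; no sign information on the competitor is needed.
  · have heq := (h'.isSignedKacSol hV hlam hT.le).eqOn (h.isSignedKacSol hT.le) hlam.le hT.le (by
      rw [h'.init_density, h'.init_flux, h.init]
      exact KacFC.projInv_proj hV σ₀)
    have key : ∀ t ∈ Set.Icc 0 T, (ρ' t, ω' t) = KacFC.proj (σ t) := fun t ht => by
      rw [← heq ht, KacFC.proj_projInv hV]
    exact ⟨fun t ht => congrArg Prod.fst (key t ht), fun t ht => congrArg Prod.snd (key t ht)⟩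
  · exact (h'.isSignedKacSol hT.le).eqOn (h.isSignedKacSol hV hlam hT.le) hlam.le hT.le (by
      rw [h'.init, h.init_density, h.init_flux])
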